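/- Let $\Lambda$ be a finite-dimensional non-semisimple algebra over a field $k$, and let $\mathcal P(\Lambda)$ be the category of finitely generated projective right $\Lambda$-modules. A minimal projective complex is a complex $X=(X^i,d^i)_{i\in\mathbb Z}$ over $\mathcal P(\Lambda)$ such that $\operatorname{Im} d^i\subseteq \operatorname{rad} X^{i+1}$ for all $i$. For an interval $J\subseteq\mathbb Z$ (bounded or not, possibly $J=\mathbb Z$), let $\mathcal K_{\mathcal I}^J(\mathcal P(\Lambda))$ be the full subcategory of the homotopy category $\mathcal K(\mathcal P(\Lambda))$ consisting of the minimal projective complexes whose cells are zero outside $J$. A morphism $f$ of $\mathcal P(\Lambda)$ is irreducible if it is neither a split monomorphism nor a split epimorphism and, for every factorization $f=hg$ in $\mathcal P(\Lambda)$, either $h$ is a split epimorphism or $g$ is a split monomorphism. A morphism of complexes $f=(f^i)$ is called smonic (resp. sepic) if all $f^i$ are split monomorphisms (resp. split epimorphisms); it is called sirreducible if there is exactly one index $i_0$ such that $f^{i_0}$ is irreducible in $\mathcal P(\Lambda)$, $f^i$ is a split epimorphism for all $i<i_0$, and $f^i$ is a split monomorphism for all $i>i_0$. An Auslander-Reiten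 triangle in $\mathcal K_{\mathcal I}^J(\mathcal P(\Lambda))$ is a distinguished triangle $X\xrightarrow{u}Y\xrightarrow{v}Z\xrightarrow{w}X[1]$ of $\mathcal K(\mathcal P(\Lambda))$ with $X,Y,Z$ in $\mathcal K_{\mathcal I}^J(\mathcal P(\Lambda))$ such that $X$ and $Z$ are indecomposable, $w\neq 0$, and every morphism $W\to Z$ with $W$ in $\mathcal K_{\mathcal I}^J(\mathcal P(\Lambda))$ that is not a split epimorphism factors through $v$. **Theorem 1.** Let $X\xrightarrow{u}Y\xrightarrow{v}Z\xrightarrow{w}X[1]$ be an Auslander-Reiten triangle in $\mathcal K_{\mathcal I}^J(\mathcal P(\Lambda))$, where $u$ and $v$ are represented by arbitrary morphisms of complexes, again denoted $u$ and $v$. (a) If $u$ is smonic, then $v$ is sepic. (b) If $u$ is sepic and $Y\neq 0$, then $v$ is sirreducible. (c) If $u$ is sirreducible, then $v$ is smonic or sirreducible. -/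

import Mathlib

open CategoryTheory Limits Pretriangulated

universe u

/-! ### Finitely generated projective right modules -/

/-- The property, for a right `Λ`-module (that is, a module over `Λᵐᵒᵖ`), of being finitely
generated and projective. -/
def isFGProjective (Λ : Type u) [Ring Λ] : ObjectProperty (ModuleCat.{u} Λᵐᵒᵖ) :=
  fun M => Module.Finite Λᵐᵒᵖ M ∧ Module.Projective Λᵐᵒᵖ M

/-- The category `P(Λ)`: the full subcategory of right `Λ`-modules consisting of the finitely
generated projective ones. -/
abbrev ProjCat (Λ : Type u) [Ring Λ] := (isFGProjective Λ).FullSubcategory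

section Instances

variable (Λ : Type u) [Ring Λ]

lemma isFGProjective_of_iso {M N : ModuleCat.{u} Λᵐᵒᵖ} (e : M ≅ N)
    (hM : isFGProjective Λ M) : isFGProjective Λ N := by
  have h1 := hM.1
  have h2 := hM.2
  exact ⟨Module.Finite.equiv e.toLinearEquiv, Module.Projective.of_equiv e.toLinearEquiv⟩

instance : (isFGProjective Λ).IsClosedUnderIsomorphisms where
  of_iso e h := isFGProjective_of_iso Λ e h

instance : (isFGProjective Λ).ContainsZero where
  exists_zero := ⟨ModuleCat.of Λᵐᵒᵖ PUnit.{u + 1}, ModuleCat.isZero_of_subsingleton _,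
    ⟨inferInstanceAs (Module.Finite Λᵐᵒᵖ PUnit.{u + 1}), inferInstanceAs (Module.Projective Λᵐᵒᵖ PUnit.{u + 1})⟩⟩

lemma isFGProjective_prod {M N : ModuleCat.{u} Λᵐᵒᵖ} (hM : isFGProjective Λ M)
    (hN : isFGProjective Λ N) : isFGProjective Λ (ModuleCat.of Λᵐᵒᵖ (M × N)) := by
  have h1 := hM.1
  have h2 := hM.2
  have h3 := hN.1
  have h4 := hN.2
  exact ⟨inferInstanceAs (Module.Finite Λᵐᵒᵖ (M × N)),
    inferInstanceAs (Module.Projective Λᵐᵒᵖ (M × N))⟩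

instance : (isFGProjective Λ).IsClosedUnderBinaryProducts where
  limitsOfShape_le := by
    rintro X ⟨p⟩
    have hl := p.prop_diag_obj ⟨WalkingPair.left⟩
    have hr := p.prop_diag_obj ⟨WalkingPair.right⟩
    let e : p.diag ≅ pair (p.diag.obj ⟨WalkingPair.left⟩) (p.diag.obj ⟨WalkingPair.right⟩) :=
      diagramIsoPair _
    let e' : X ≅ ModuleCat.of Λᵐᵒᵖ
        (p.diag.obj ⟨WalkingPair.left⟩ × p.diag.obj ⟨WalkingPair.right⟩) :=
      IsLimit.conePointsIsoOfNatIso p.isLimit (ModuleCat.binaryProductLimitCone _ _).isLimit e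
    exact isFGProjective_of_iso Λ e'.symm (isFGProjective_prod Λ hl hr)

instance : (isFGProjective Λ).IsClosedUnderFiniteProducts := .mk'

instance : HasBinaryBiproducts (ProjCat Λ) :=
  HasBinaryBiproducts.of_hasBinaryProducts

end Instances

/-! ### Irreducible morphisms and the three types of morphisms of complexes -/

section General

variable {A : Type*} [Category* A]

/-- A morphism `f` is irreducible if it is neither a split monomorphism nor a split epimorphism
and if, for every factorization `f = g ≫ h` (first `g`, then `h`), either `g` is a split
monomorphism or `h` is a split epimorphism. -/
def IsIrreducibleMor {X Y : A} (f : X ⟶ Y) : Prop :=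
  ¬ IsSplitMono f ∧ ¬ IsSplitEpi f ∧
    ∀ (M : A) (g : X ⟶ M) (h : M ⟶ Y), g ≫ h = f → IsSplitEpi h ∨ IsSplitMono g

variable [HasZeroMorphisms A] {X Y : CochainComplex A ℤ}

/-- All components are split monomorphisms. -/
def IsSmonic (f : X ⟶ Y) : Prop := ∀ i : ℤ, IsSplitMono (f.f i)

/-- All components are split epimorphisms. -/
def IsSepic (f : X ⟶ Y) : Prop := ∀ i : ℤ, IsSplitEpi (f.f i)

/-- There is exactly one index `i₀` such that the component at `i₀` is irreducible, all the
components before `i₀` are split epimorphisms, and all those after `i₀` are split monomorphisms. -/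
def IsSirreducible (f : X ⟶ Y) : Prop :=
  ∃! i₀ : ℤ, IsIrreducibleMor (f.f i₀) ∧ (∀ i < i₀, IsSplitEpi (f.f i)) ∧
    (∀ i > i₀, IsSplitMono (f.f i))

end General

/-! ### Auslander-Reiten triangles -/

section AuslanderReiten

variable {T : Type*} [Category* T] [HasZeroObject T] [HasShift T ℤ] [Preadditive T]
  [∀ n : ℤ, (shiftFunctor T n).Additive] [Pretriangulated T]

/-- `X` is an indecomposable object of the full subcategory `S` of `T`: it is nonzero, and it is
not the direct sum of two nonzero objects of `S`. -/
def IsIndecomposableIn (S : ObjectProperty T) (X : T) : Prop :=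
  S X ∧ ¬ IsZero X ∧ ∀ U V : T, S U → S V → (X ≅ U ⊞ V) → IsZero U ∨ IsZero V

/-- A distinguished triangle `X ⟶ Y ⟶ Z ⟶ X⟦1⟧` of `T` with `X`, `Y`, `Z` in the full
subcategory `S` is an Auslander-Reiten triangle in `S` if `X` and `Z` are indecomposable in `S`,
the morphism `Z ⟶ X⟦1⟧` is nonzero, and every morphism `W ⟶ Z` with `W` in `S` which is not a
split epimorphism factors through `Y ⟶ Z`. -/
structure IsAuslanderReitenTriangle (S : ObjectProperty T) (D : Triangle T) : Prop where
  distinguished : D ∈ distTriang T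
  indecomposable₁ : IsIndecomposableIn S D.obj₁
  mem₂ : S D.obj₂
  indecomposable₃ : IsIndecomposableIn S D.obj₃
  mor₃_ne_zero : D.mor₃ ≠ 0
  exists_lift : ∀ (W : T), S W → ∀ f : W ⟶ D.obj₃, ¬ IsSplitEpi f →
    ∃ f' : W ⟶ D.obj₂, f' ≫ D.mor₂ = f

end AuslanderReiten

/-! ### Minimal projective complexes -/

section Minimal

variable {Λ : Type u} [Ring Λ]

/-- A complex of finitely generated projective modules is minimal if the image of each
differential is contained in the radical of the target. -/
def IsMinimalComplex (X : CochainComplex (ProjCat Λ) ℤ) : Prop :=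
  ∀ i j : ℤ, LinearMap.range (X.d i j).hom.hom ≤ Module.jacobson Λᵐᵒᵖ (X.X j).obj

variable (Λ) in
/-- The minimal projective complexes whose cells are zero outside `J`, as a class of objects of
the homotopy category of complexes over `P(Λ)`: the objects of the full subcategory
`K_I^J(P(Λ))`. -/
def minimalOn (J : Set ℤ) : ObjectProperty (HomotopyCategory (ProjCat Λ) (ComplexShape.up ℤ)) :=
  fun X => IsMinimalComplex X.as ∧ ∀ i : ℤ, i ∉ J → IsZero (X.as.X i)

end Minimal

/-! A homotopy contributes only terms passing through a differential, so homotopic morphisms between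
minimal complexes differ by radical maps in each degree (`isRadicalMor_sub_of_map_eq`). By Nakayama,
splitting in the homotopy category therefore forces degreewise splitting.

Fitting's decomposition shows that each endomorphism `a` of the indecomposable `X` has `a` or `1 -
a` invertible. With `w ≠ 0` this makes `v` right minimal, and the lifting property turns right
minimality into irreducibility: if `v = p ≫ q` through a minimal complex on `J`, then `p` is smonic
or `q` is sepic (`isSmonic_or_isSepic_of_comp_eq`). Testing this on complexes spliced from `Y` and
`Z`, and on the image of `v`, shows that `v` is smonic, sepic or sirreducible
(`isSmonic_or_isSepic_or_isSirreducible`).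

Computing modulo the radical in the mapping cone of `u` shows that `u` is smonic exactly when `v` is
sepic. This gives (a), and excludes sepic `v` in (c). In (b), `u ≫ v` is null-homotopic and `u` is
sepic, so `v` is radical in each degree; a smonic `v` would give `Y = 0` and a sepic one `Z = 0`. -/

/-! ### The radical of the category of finitely generated projective modules -/

section Radical

variable {Λ : Type u} [Ring Λ] {P Q R : ProjCat Λ}

/-- A morphism of `P(Λ)` is radical if its image is contained in the radical of its target. -/
def IsRadicalMor (f : P ⟶ Q) : Prop :=
  LinearMap.range f.hom.hom ≤ Module.jacobson Λᵐᵒᵖ Q.obj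

namespace IsRadicalMor

lemma comp_left {f : P ⟶ Q} (hf : IsRadicalMor f) (g : R ⟶ P) : IsRadicalMor (g ≫ f) := by
  rintro _ ⟨x, rfl⟩
  exact hf ⟨g.hom.hom x, rfl⟩

lemma comp_right {f : P ⟶ Q} (hf : IsRadicalMor f) (g : Q ⟶ R) : IsRadicalMor (f ≫ g) := by
  rintro _ ⟨x, rfl⟩
  exact Module.le_comap_jacobson g.hom.hom (hf ⟨x, rfl⟩)

lemma add {f g : P ⟶ Q} (hf : IsRadicalMor f) (hg : IsRadicalMor g) : IsRadicalMor (f + g) := by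
  rintro _ ⟨x, rfl⟩
  exact add_mem (hf ⟨x, rfl⟩) (hg ⟨x, rfl⟩)

lemma neg {f : P ⟶ Q} (hf : IsRadicalMor f) : IsRadicalMor (-f) := by
  rintro _ ⟨x, rfl⟩
  exact neg_mem (hf ⟨x, rfl⟩)

lemma sub {f g : P ⟶ Q} (hf : IsRadicalMor f) (hg : IsRadicalMor g) : IsRadicalMor (f - g) := by
  rw [sub_eq_add_neg]
  exact hf.add hg.neg

lemma of_comp_splitMono {f : P ⟶ Q} {g : Q ⟶ R} (h : IsRadicalMor (f ≫ g)) [IsSplitMono g] :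
    IsRadicalMor f := by
  simpa using h.comp_right (retraction g)

lemma of_splitEpi_comp {f : P ⟶ Q} {g : Q ⟶ R} (h : IsRadicalMor (f ≫ g)) [IsSplitEpi f] :
    IsRadicalMor g := by
  simpa using h.comp_left (section_ f)

end IsRadicalMor

lemma isRadicalMor_zero : IsRadicalMor (0 : P ⟶ Q) := by
  rintro _ ⟨x, rfl⟩
  exact zero_mem _

lemma isIso_of_bijective {f : P ⟶ Q} (hf : Function.Bijective f.hom.hom) : IsIso f := by
  have : IsIso f.hom := (ConcreteCategory.isIso_iff_bijective f.hom).2 hf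
  exact ⟨⟨inv f.hom⟩, by ext1; exact IsIso.hom_inv_id f.hom, by ext1; exact IsIso.inv_hom_id f.hom⟩

variable [IsArtinianRing Λᵐᵒᵖ]

/-- Nakayama: a maximal submodule containing the range of `f` also contains the radical, hence
everything. So `f` is onto, and a surjective endomorphism of a Noetherian module is bijective. -/
lemma isIso_of_isRadicalMor_sub_id {f : P ⟶ P} (h : IsRadicalMor (f - 𝟙 P)) : IsIso f := by
  have : Module.Finite Λᵐᵒᵖ P.obj := P.property.1
  refine isIso_of_bijective (IsNoetherian.bijective_of_surjective_endomorphism _ ?_)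
  rw [← LinearMap.range_eq_top]
  by_contra hr
  obtain ⟨m, hm, hfm⟩ := (eq_top_or_exists_le_coatom (LinearMap.range f.hom.hom)).resolve_left hr
  refine hm.1 (eq_top_iff.2 fun x _ => ?_)
  have h1 : (f - 𝟙 P).hom.hom x ∈ m := (sInf_le hm : Module.jacobson Λᵐᵒᵖ P.obj ≤ m) (h ⟨x, rfl⟩)
  have h2 : f.hom.hom x ∈ m := hfm ⟨x, rfl⟩
  have h3 : f.hom.hom x - (f - 𝟙 P).hom.hom x = x := by
    change f.hom.hom x - (f.hom.hom x - x) = x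
    abel
  rw [← h3]
  exact sub_mem h2 h1

lemma isSplitMono_of_isRadicalMor_comp_sub_id {f : P ⟶ Q} {g : Q ⟶ P}
    (h : IsRadicalMor (f ≫ g - 𝟙 P)) : IsSplitMono f := by
  have := isIso_of_isRadicalMor_sub_id h
  exact ⟨⟨g ≫ inv (f ≫ g), by rw [← Category.assoc]; exact IsIso.hom_inv_id _⟩⟩

lemma isSplitEpi_of_isRadicalMor_comp_sub_id {f : P ⟶ Q} {g : Q ⟶ P}
    (h : IsRadicalMor (g ≫ f - 𝟙 Q)) : IsSplitEpi f := by
  have := isIso_of_isRadicalMor_sub_id h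
  exact ⟨⟨inv (g ≫ f) ≫ g, by rw [Category.assoc]; exact IsIso.inv_hom_id _⟩⟩

lemma isSplitEpi_of_isRadicalMor_sub {f f' : P ⟶ Q} [IsSplitEpi f]
    (h : IsRadicalMor (f' - f)) : IsSplitEpi f' :=
  isSplitEpi_of_isRadicalMor_comp_sub_id (g := section_ f)
    (by simpa [Preadditive.comp_sub] using h.comp_left (section_ f))

lemma isZero_of_isRadicalMor_id (h : IsRadicalMor (𝟙 P)) : IsZero P := by
  have : IsIso (0 : P ⟶ P) := isIso_of_isRadicalMor_sub_id (by simpa using h.neg)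
  rw [IsZero.iff_id_eq_zero]
  exact (IsIso.hom_inv_id (0 : P ⟶ P)).symm.trans zero_comp

lemma isZero_of_isRadicalMor_of_isSplitMono {f : P ⟶ Q} (h : IsRadicalMor f) [IsSplitMono f] :
    IsZero P :=
  isZero_of_isRadicalMor_id (by simpa using h.comp_right (retraction f))

lemma isZero_of_isRadicalMor_of_isSplitEpi {f : P ⟶ Q} (h : IsRadicalMor f) [IsSplitEpi f] :
    IsZero Q :=
  isZero_of_isRadicalMor_id (by simpa using h.comp_left (section_ f))

end Radical

/-! ### Fitting's decomposition -/

section Fitting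

variable {R : Type*} [Ring R] {M N : Type*} [AddCommGroup M] [Module R M] [AddCommGroup N]
  [Module R N]

lemma LinearMap.comp_pow_of_comp_eq {f : Module.End R M} {g : Module.End R N} {h : M →ₗ[R] N}
    (w : h ∘ₗ f = g ∘ₗ h) (n : ℕ) (x : M) : h ((f ^ n) x) = (g ^ n) (h x) := by
  induction n generalizing x with
  | zero => rfl
  | succ n ih =>
    rw [pow_succ, pow_succ, Module.End.mul_apply, Module.End.mul_apply, ih]
    exact congrArg (g ^ n) (LinearMap.congr_fun w x)

lemma Module.End.mem_iSup_ker_pow {f : Module.End R M} {x : M} :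
    x ∈ ⨆ n, LinearMap.ker (f ^ n) ↔ ∃ n : ℕ, (f ^ n) x = 0 := by
  exact Submodule.mem_iSup_of_directed (fun n => LinearMap.ker (f ^ n))
    f.iterateKer.monotone.directed_le

variable [IsArtinian R M] [IsNoetherian R M] [IsArtinian R N] [IsNoetherian R N]

/-- The projection onto the stable image of an endomorphism along its stable kernel. -/
noncomputable def Module.End.fittingProjection (f : Module.End R M) : Module.End R M :=
  Submodule.projection _ _ (LinearMap.isCompl_iSup_ker_pow_iInf_range_pow f).symm

namespace Module.End

lemma fittingProjection_idem (f : Module.End R M) (x : M) :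
    f.fittingProjection (f.fittingProjection x) = f.fittingProjection x :=
  LinearMap.congr_fun (Submodule.isIdempotentElem_projection _) x

/-- An intertwiner carries stable image to stable image and stable kernel to stable kernel, so it
respects the two components of `x`. -/
lemma fittingProjection_natural {f : Module.End R M} {g : Module.End R N} {h : M →ₗ[R] N}
    (w : h ∘ₗ f = g ∘ₗ h) (x : M) : h (f.fittingProjection x) = g.fittingProjection (h x) := by
  set hf := (LinearMap.isCompl_iSup_ker_pow_iInf_range_pow f).symm
  set hg := (LinearMap.isCompl_iSup_ker_pow_iInf_range_pow g).symm
  have h1 : h (f.fittingProjection x) ∈ ⨅ n, LinearMap.range (g ^ n) := by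
    have hx : f.fittingProjection x ∈ ⨅ n, LinearMap.range (f ^ n) :=
      Submodule.projection_apply_mem hf x
    rw [Submodule.mem_iInf] at hx ⊢
    intro n
    obtain ⟨y, hy⟩ := hx n
    exact ⟨h y, by rw [← hy, LinearMap.comp_pow_of_comp_eq w]⟩
  have h2 : h (x - f.fittingProjection x) ∈ ⨆ n, LinearMap.ker (g ^ n) := by
    obtain ⟨n, hn⟩ := mem_iSup_ker_pow.1 (Submodule.sub_projection_mem hf x)
    exact mem_iSup_ker_pow.2 ⟨n, by
      rw [← LinearMap.comp_pow_of_comp_eq w]; exact (congrArg h hn).trans (map_zero h)⟩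
  have h3 : h x = h (f.fittingProjection x) + h (x - f.fittingProjection x) := by
    rw [← map_add, add_sub_cancel]
  rw [h3, map_add]
  have e1 := Submodule.projection_apply_of_mem_left hg h1
  have e2 := (Submodule.projection_apply_eq_zero_iff hg).2 h2
  exact ((congrArg₂ (· + ·) e1 e2).trans (add_zero _)).symm

lemma bijective_of_fittingProjection_eq_id {f : Module.End R M}
    (h : ∀ x, f.fittingProjection x = x) : Function.Bijective f := by
  refine IsArtinian.bijective_of_injective_endomorphism f
    ((injective_iff_map_eq_zero f).2 fun x hx => ?_)
  rw [← h x]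
  exact (Submodule.projection_apply_eq_zero_iff _).2 (mem_iSup_ker_pow.2 ⟨1, by simpa using hx⟩)

lemma bijective_one_sub_of_fittingProjection_eq_zero {f : Module.End R M}
    (h : ∀ x, f.fittingProjection x = 0) : Function.Bijective (1 - f : Module.End R M) := by
  refine IsArtinian.bijective_of_injective_endomorphism _
    ((injective_iff_map_eq_zero _).2 fun x hx => ?_)
  obtain ⟨n, hn⟩ := mem_iSup_ker_pow.1 ((Submodule.projection_apply_eq_zero_iff _).1 (h x))
  have hfx : f x = x := (sub_eq_zero.1 hx).symm
  have : ∀ n : ℕ, (f ^ n) x = x := fun n => by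
    induction n with
    | zero => rfl
    | succ n ih => rw [pow_succ, mul_apply, hfx, ih]
  rw [← this n, hn]

end Module.End

end Fitting

/-! ### Morphisms of minimal complexes up to homotopy -/

/-- The functor from complexes over `P(Λ)` to the homotopy category. -/
noncomputable abbrev toHomotopy (Λ : Type u) [Ring Λ] :
    CochainComplex (ProjCat Λ) ℤ ⥤ HomotopyCategory (ProjCat Λ) (ComplexShape.up ℤ) :=
  HomotopyCategory.quotient (ProjCat Λ) (ComplexShape.up ℤ)

section Homotopy

variable {Λ : Type u} [Ring Λ] {X Y Z : CochainComplex (ProjCat Λ) ℤ}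

lemma exists_homotopy_components {f g : X ⟶ Y} (h : (toHomotopy Λ).map f = (toHomotopy Λ).map g)
    (i : ℤ) : ∃ (s : X.X (i + 1) ⟶ Y.X i) (t : X.X i ⟶ Y.X (i - 1)),
      f.f i = X.d i (i + 1) ≫ s + t ≫ Y.d (i - 1) i + g.f i := by
  let H := HomotopyCategory.homotopyOfEq f g h
  refine ⟨H.hom (i + 1) i, H.hom i (i - 1), ?_⟩
  rw [H.comm i, dNext_eq H.hom (show (ComplexShape.up ℤ).Rel i (i + 1) from rfl),
    prevD_eq H.hom (show (ComplexShape.up ℤ).Rel (i - 1) i by simp)]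

lemma isZero_of_isZero_X (h : ∀ i, IsZero (Y.X i)) : IsZero Y := by
  rw [IsZero.iff_id_eq_zero]
  ext1 i
  exact (h i).eq_of_src _ _

lemma IsMinimalComplex.isRadicalMor_d (hX : IsMinimalComplex X) (i j : ℤ) :
    IsRadicalMor (X.d i j) := hX i j

/-- Each homotopy term contains a differential of `X` or of `Y`, which is radical by minimality. -/
lemma isRadicalMor_sub_of_map_eq (hX : IsMinimalComplex X) (hY : IsMinimalComplex Y)
    {f g : X ⟶ Y} (h : (toHomotopy Λ).map f = (toHomotopy Λ).map g) (i : ℤ) :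
    IsRadicalMor (f.f i - g.f i) := by
  obtain ⟨s, t, hst⟩ := exists_homotopy_components h i
  rw [hst, add_sub_cancel_right]
  exact ((hX.isRadicalMor_d _ _).comp_right s).add ((hY.isRadicalMor_d _ _).comp_left t)

lemma isZero_X_of_minimalOn {J : Set ℤ} (hX : minimalOn Λ J ((toHomotopy Λ).obj X)) {i : ℤ}
    (hi : i ∉ J) : IsZero (X.X i) := hX.2 i hi

variable [IsArtinianRing Λᵐᵒᵖ]

/-- A retraction up to homotopy is, in each degree, a retraction modulo the radical, which can be
corrected to a genuine one. -/
lemma isSmonic_of_isSplitMono_map (hX : IsMinimalComplex X) {f : X ⟶ Y}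
    (h : IsSplitMono ((toHomotopy Λ).map f)) : IsSmonic f := fun i => by
  obtain ⟨g, hg⟩ := (toHomotopy Λ).map_surjective (retraction ((toHomotopy Λ).map f))
  have h1 : (toHomotopy Λ).map (f ≫ g) = (toHomotopy Λ).map (𝟙 X) := by
    rw [Functor.map_comp, hg, IsSplitMono.id, CategoryTheory.Functor.map_id]
  exact isSplitMono_of_isRadicalMor_comp_sub_id (isRadicalMor_sub_of_map_eq hX hX h1 i)

lemma isSepic_of_isSplitEpi_map (hY : IsMinimalComplex Y) {f : X ⟶ Y}
    (h : IsSplitEpi ((toHomotopy Λ).map f)) : IsSepic f := fun i => by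
  obtain ⟨g, hg⟩ := (toHomotopy Λ).map_surjective (section_ ((toHomotopy Λ).map f))
  have h1 : (toHomotopy Λ).map (g ≫ f) = (toHomotopy Λ).map (𝟙 Y) := by
    rw [Functor.map_comp, hg, IsSplitEpi.id, CategoryTheory.Functor.map_id]
  exact isSplitEpi_of_isRadicalMor_comp_sub_id (isRadicalMor_sub_of_map_eq hY hY h1 i)

lemma isZero_X_of_isZero (hX : IsMinimalComplex X)
    (h : IsZero ((toHomotopy Λ).obj X)) (i : ℤ) : IsZero (X.X i) := by
  have h1 : (toHomotopy Λ).map (𝟙 X) = (toHomotopy Λ).map 0 := h.eq_of_src _ _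
  exact isZero_of_isRadicalMor_id (by simpa using isRadicalMor_sub_of_map_eq hX hX h1 i)

end Homotopy

/-! ### Endomorphisms of indecomposable complexes -/

section Idempotents

instance (Λ : Type u) [Ring Λ] : IsIdempotentComplete (ProjCat Λ) where
  idempotents_split P p hp := by
    have h1 : Module.Finite Λᵐᵒᵖ P.obj := P.property.1
    have h2 : Module.Projective Λᵐᵒᵖ P.obj := P.property.2
    have hp' (x : P.obj) : p.hom.hom (p.hom.hom x) = p.hom.hom x :=
      congrArg (fun f : P ⟶ P => f.hom.hom x) hp
    let e : P.obj →ₗ[Λᵐᵒᵖ] LinearMap.range p.hom.hom := p.hom.hom.rangeRestrict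
    have he (x : LinearMap.range p.hom.hom) : e x.1 = x := by
      obtain ⟨_, x, rfl⟩ := x
      exact Subtype.ext (hp' x)
    let M : ProjCat Λ := ⟨ModuleCat.of Λᵐᵒᵖ (LinearMap.range p.hom.hom),
      inferInstanceAs (Module.Finite Λᵐᵒᵖ (LinearMap.range p.hom.hom)),
      Module.Projective.of_split (Submodule.subtype _) e (LinearMap.ext he)⟩
    refine ⟨M, ⟨ModuleCat.ofHom (Submodule.subtype _)⟩, ⟨ModuleCat.ofHom e⟩, ?_, ?_⟩
    · ext x
      exact congrArg Subtype.val (he x)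
    · ext x
      rfl

lemma exists_splitting_of_idempotent {A : Type*} [Category* A] [Preadditive A]
    [IsIdempotentComplete A] (X : CochainComplex A ℤ) (e : X ⟶ X) (he : e ≫ e = e) :
    ∃ (U : CochainComplex A ℤ) (ι : U ⟶ X) (π : X ⟶ U), ι ≫ π = 𝟙 U ∧ π ≫ ι = e := by
  have he' (i : ℤ) : e.f i ≫ e.f i = e.f i := by
    rw [← HomologicalComplex.comp_f, he]
  choose U ι π h1 h2 using fun i => IsIdempotentComplete.idempotents_split _ _ (he' i)
  have h3 (i : ℤ) : ι i ≫ e.f i = ι i := by rw [← h2, reassoc_of% (h1 i)]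
  have h4 (i : ℤ) : e.f i ≫ π i = π i := by rw [← h2, Category.assoc, h1, Category.comp_id]
  let U' : CochainComplex A ℤ :=
    { X := U
      d := fun i j => ι i ≫ X.d i j ≫ π j
      shape := fun i j hij => by rw [X.shape i j hij]; simp
      d_comp_d' := fun i j k _ _ => by
        simp only [Category.assoc]
        rw [reassoc_of% (h2 j), e.comm_assoc, X.d_comp_d_assoc]
        simp }
  refine ⟨U', { f := ι, comm' := fun i j _ => ?_ }, { f := π, comm' := fun i j _ => ?_ }, ?_, ?_⟩
  · change ι i ≫ X.d i j = (ι i ≫ X.d i j ≫ π j) ≫ ι j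
    simp only [Category.assoc]
    rw [h2, ← e.comm, reassoc_of% (h3 i)]
  · change π i ≫ ι i ≫ X.d i j ≫ π j = X.d i j ≫ π j
    rw [reassoc_of% (h2 i), e.comm_assoc, h4]
  · ext i
    exact h1 i
  · ext i
    exact h2 i

variable {Λ : Type u} [Ring Λ] {J : Set ℤ} {X Y : CochainComplex (ProjCat Λ) ℤ}

lemma minimalOn_of_splitMono {U : CochainComplex (ProjCat Λ) ℤ}
    (hX : minimalOn Λ J ((toHomotopy Λ).obj X)) (ι : U ⟶ X) (π : X ⟶ U) (h : ι ≫ π = 𝟙 U) :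
    minimalOn Λ J ((toHomotopy Λ).obj U) := by
  have h' (i : ℤ) : ι.f i ≫ π.f i = 𝟙 _ := by rw [← HomologicalComplex.comp_f, h]; rfl
  refine ⟨fun i j => ?_, fun i hi => ?_⟩
  · have : U.d i j = ι.f i ≫ X.d i j ≫ π.f j := by rw [ι.comm_assoc, h', Category.comp_id]
    change IsRadicalMor (U.d i j)
    rw [this]
    exact ((hX.1.isRadicalMor_d i j).comp_right _).comp_left _
  · rw [IsZero.iff_id_eq_zero]
    change 𝟙 (U.X i) = 0
    rw [← h', (isZero_X_of_minimalOn hX hi).eq_of_tgt (ι.f i) 0, zero_comp]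

variable [IsArtinianRing Λᵐᵒᵖ]

/-- Both `e` and `1 - e` split already as chain maps, with minimal summands. Indecomposability kills
one summand up to homotopy, and a contractible minimal complex is zero in every degree. -/
lemma eq_zero_or_eq_id_of_idempotent
    (hX : IsIndecomposableIn (minimalOn Λ J) ((toHomotopy Λ).obj X))
    (e : X ⟶ X) (he : e ≫ e = e) : e = 0 ∨ e = 𝟙 X := by
  have he' : (𝟙 X - e) ≫ (𝟙 X - e) = 𝟙 X - e := by simp [he]
  obtain ⟨U, ι, π, h1, h2⟩ := exists_splitting_of_idempotent X e he
  obtain ⟨V, ι', π', h1', h2'⟩ := exists_splitting_of_idempotent X (𝟙 X - e) he'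
  have hU := minimalOn_of_splitMono hX.1 ι π h1
  have hV := minimalOn_of_splitMono hX.1 ι' π' h1'
  have h3 : ι ≫ π' = 0 := by
    have : ι ≫ e ≫ (𝟙 X - e) ≫ π' = ι ≫ π' := by
      rw [← h2', ← h2]; simp [h1', reassoc_of% h1]
    rw [← this]
    simp [reassoc_of% he]
  have h4 : ι' ≫ π = 0 := by
    have : ι' ≫ (𝟙 X - e) ≫ e ≫ π = ι' ≫ π := by
      rw [← h2', ← h2]; simp [h1, reassoc_of% h1']
    rw [← this]
    simp [reassoc_of% he]
  let b : BinaryBicone ((toHomotopy Λ).obj U) ((toHomotopy Λ).obj V) :=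
    { pt := (toHomotopy Λ).obj X
      fst := (toHomotopy Λ).map π
      snd := (toHomotopy Λ).map π'
      inl := (toHomotopy Λ).map ι
      inr := (toHomotopy Λ).map ι'
      inl_fst := by rw [← Functor.map_comp, h1, CategoryTheory.Functor.map_id]
      inl_snd := by rw [← Functor.map_comp, h3, Functor.map_zero]
      inr_fst := by rw [← Functor.map_comp, h4, Functor.map_zero]
      inr_snd := by rw [← Functor.map_comp, h1', CategoryTheory.Functor.map_id] }
  have hb : b.IsBilimit := isBinaryBilimitOfTotal b (by
    change (toHomotopy Λ).map π ≫ (toHomotopy Λ).map ι +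
      (toHomotopy Λ).map π' ≫ (toHomotopy Λ).map ι' = 𝟙 ((toHomotopy Λ).obj X)
    rw [← Functor.map_comp, ← Functor.map_comp, ← Functor.map_add, h2, h2', add_sub_cancel,
      CategoryTheory.Functor.map_id])
  refine (hX.2.2 _ _ hU hV (biprod.uniqueUpToIso _ _ hb)).imp (fun h => ?_) (fun h => ?_)
  · rw [← h2]
    ext1 i
    exact (congrArg (· ≫ ι.f i) ((isZero_X_of_isZero hU.1 h i).eq_of_tgt (π.f i) 0)).trans
      zero_comp
  · rw [eq_comm, ← sub_eq_zero, ← h2']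
    ext1 i
    exact (congrArg (· ≫ ι'.f i) ((isZero_X_of_isZero hV.1 h i).eq_of_tgt (π'.f i) 0)).trans
      zero_comp

lemma isIso_or_isIso_id_sub
    (hX : IsIndecomposableIn (minimalOn Λ J) ((toHomotopy Λ).obj X)) (a : X ⟶ X) :
    IsIso a ∨ IsIso (𝟙 X - a) := by
  have (i : ℤ) : Module.Finite Λᵐᵒᵖ (X.X i).obj := (X.X i).property.1
  -- Naturality makes the degreewise Fitting projections a chain map. The stabilizing exponent may
  -- depend on the degree, so no boundedness is needed.
  let e : X ⟶ X :=
    { f := fun i => ⟨ModuleCat.ofHom (Module.End.fittingProjection (a.f i).hom.hom)⟩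
      comm' := fun i j _ => by
        ext x
        refine Module.End.fittingProjection_natural (f := (a.f i).hom.hom) (g := (a.f j).hom.hom)
          (h := (X.d i j).hom.hom) ?_ x
        ext y
        exact congrArg (fun f : X.X i ⟶ X.X j => f.hom.hom y) (a.comm i j) }
  have he : e ≫ e = e := by
    ext i x
    exact Module.End.fittingProjection_idem _ x
  rcases eq_zero_or_eq_id_of_idempotent hX e he with h | h
  · refine Or.inr (@HomologicalComplex.Hom.isIso_of_components _ _ _ _ _ _ _ _
      fun i => isIso_of_bijective ?_)
    exact Module.End.bijective_one_sub_of_fittingProjection_eq_zero fun x =>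
      congrArg (fun f : X ⟶ X => (f.f i).hom.hom x) h
  · refine Or.inl (@HomologicalComplex.Hom.isIso_of_components _ _ _ _ _ _ _ _
      fun i => isIso_of_bijective ?_)
    exact Module.End.bijective_of_fittingProjection_eq_id fun x =>
      congrArg (fun f : X ⟶ X => (f.f i).hom.hom x) h

end Idempotents

/-! ### Factorizations of morphisms of complexes -/

section Factorizations

/-- Objects `W i` with maps `δ i : W i ⟶ W (i + 1)` of square zero form a complex, through which
maps from `Y` and to `Z` compatible with the differentials become morphisms of complexes. -/
lemma exists_complex_of_components {A : Type*} [Category* A] [Preadditive A]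
    {Y Z : CochainComplex A ℤ} (W : ℤ → A)
    (p : ∀ i, Y.X i ⟶ W i) (q : ∀ i, W i ⟶ Z.X i) (δ : ∀ i, W i ⟶ W (i + 1))
    (hp : ∀ i, p i ≫ δ i = Y.d i (i + 1) ≫ p (i + 1))
    (hq : ∀ i, δ i ≫ q (i + 1) = q i ≫ Z.d i (i + 1)) (hδ : ∀ i, δ i ≫ δ (i + 1) = 0) :
    ∃ (C : CochainComplex A ℤ) (e : ∀ i, C.X i = W i) (f : Y ⟶ C) (g : C ⟶ Z),
      (∀ i, f.f i = p i ≫ eqToHom (e i).symm) ∧ (∀ i, g.f i = eqToHom (e i) ≫ q i) ∧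
      ∀ i, C.d i (i + 1) = eqToHom (e i) ≫ δ i ≫ eqToHom (e (i + 1)).symm := by
  have hd (i : ℤ) : (CochainComplex.of W δ hδ).d i (i + 1) = δ i := CochainComplex.of_d ..
  refine ⟨CochainComplex.of W δ hδ, fun _ => rfl, { f := p, comm' := ?_ },
    { f := q, comm' := ?_ }, by simp, by simp, fun i => by simp⟩
  · rintro i _ rfl
    rw [hd]
    exact hp i
  · rintro i _ rfl
    rw [hd]
    exact (hq i).symm

variable {Λ : Type u} [Ring Λ] {J : Set ℤ} {Y Z : CochainComplex (ProjCat Λ) ℤ}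

lemma isMinimalComplex_of_succ {X : CochainComplex (ProjCat Λ) ℤ}
    (h : ∀ i, IsRadicalMor (X.d i (i + 1))) : IsMinimalComplex X := by
  intro i j
  by_cases hij : i + 1 = j
  · subst hij
    exact h i
  · rw [X.shape i j hij]
    exact isRadicalMor_zero

/-- Splicing: a factorization of one component of `v` extends to a factorization of `v` through
a minimal complex which agrees with `Y` below and with `Z` above. -/
lemma exists_splice (hY : minimalOn Λ J ((toHomotopy Λ).obj Y))
    (hZ : minimalOn Λ J ((toHomotopy Λ).obj Z)) (v : Y ⟶ Z) (n : ℤ) {M : ProjCat Λ}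
    (g : Y.X n ⟶ M) (h : M ⟶ Z.X n) (w : g ≫ h = v.f n) (hM : n ∉ J → IsZero M) :
    ∃ (W : CochainComplex (ProjCat Λ) ℤ) (p : Y ⟶ W) (q : W ⟶ Z),
      minimalOn Λ J ((toHomotopy Λ).obj W) ∧ p ≫ q = v ∧ (∀ i < n, IsIso (p.f i)) ∧
      (∀ i > n, IsIso (q.f i)) ∧ (IsSplitMono (p.f n) → IsSplitMono g) ∧
      (IsSplitEpi (q.f n) → IsSplitEpi h) := by
  have key (i : ℤ) : ∃ (W : ProjCat Λ) (p : Y.X i ⟶ W) (q : W ⟶ Z.X i), (i ∉ J → IsZero W) ∧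
      p ≫ q = v.f i ∧ (i < n → IsIso p) ∧ (i > n → IsIso q) ∧
      (i = n → IsSplitMono p → IsSplitMono g) ∧ (i = n → IsSplitEpi q → IsSplitEpi h) := by
    rcases lt_trichotomy i n with hi | rfl | hi
    · exact ⟨Y.X i, 𝟙 _, v.f i, isZero_X_of_minimalOn hY, Category.id_comp _,
        fun _ => inferInstance, fun h => by lia, fun h => by lia, fun h => by lia⟩
    · exact ⟨M, g, h, hM, w, fun h => by lia, fun h => by lia, fun _ => id, fun _ => id⟩
    · exact ⟨Z.X i, v.f i, 𝟙 _, isZero_X_of_minimalOn hZ, Category.comp_id _,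
        fun h => by lia, fun _ => inferInstance, fun h => by lia, fun h => by lia⟩
  choose W p q hW hpq hp hq hg hh using key
  -- The differential is forced: for `i < n` the map `p i` is invertible, and for `i ≥ n` the map `q
  -- (i + 1)` is.
  have hδ (i : ℤ) : ∃ δ : W i ⟶ W (i + 1), p i ≫ δ = Y.d i (i + 1) ≫ p (i + 1) ∧
      δ ≫ q (i + 1) = q i ≫ Z.d i (i + 1) ∧ IsRadicalMor δ := by
    by_cases hi : i < n
    · have := hp i hi
      refine ⟨inv (p i) ≫ Y.d i (i + 1) ≫ p (i + 1), by simp, ?_,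
        ((hY.1.isRadicalMor_d _ _).comp_right _).comp_left _⟩
      rw [← cancel_epi (p i)]
      simp [hpq, reassoc_of% (hpq i)]
    · have := hq (i + 1) (by lia)
      refine ⟨q i ≫ Z.d i (i + 1) ≫ inv (q (i + 1)), ?_, by simp,
        ((hZ.1.isRadicalMor_d _ _).comp_right _).comp_left _⟩
      rw [← cancel_mono (q (i + 1))]
      simp [hpq, reassoc_of% (hpq i)]
  choose δ hδp hδq hδr using hδ
  have hδδ (i : ℤ) : δ i ≫ δ (i + 1) = 0 := by
    by_cases hi : i < n
    · have := hp i hi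
      rw [← cancel_epi (p i), reassoc_of% (hδp i), hδp, Y.d_comp_d_assoc]
      simp
    · have := hq (i + 1 + 1) (by lia)
      rw [← cancel_mono (q (i + 1 + 1)), Category.assoc, hδq, reassoc_of% (hδq i), Z.d_comp_d]
      simp
  obtain ⟨C, e, f, r, hf, hr, hd⟩ := exists_complex_of_components W p q δ hδp hδq hδδ
  refine ⟨C, f, r, ⟨isMinimalComplex_of_succ fun i => ?_, fun i hi => ?_⟩, ?_, fun i hi => ?_,
    fun i hi => ?_, fun H => hg n rfl ?_, fun H => hh n rfl ?_⟩
  · change IsRadicalMor (C.d i (i + 1))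
    rw [hd]
    exact ((hδr i).comp_right _).comp_left _
  · change IsZero (C.X i)
    rw [e]
    exact hW i hi
  · ext1 i
    rw [HomologicalComplex.comp_f, hf, hr]
    simp [hpq]
  · have := hp i hi
    rw [hf]
    infer_instance
  · have := hq i hi
    rw [hr]
    infer_instance
  · have : p n = f.f n ≫ eqToHom (e n) := by simp [hf]
    rw [this]
    infer_instance
  · have : q n = eqToHom (e n).symm ≫ r.f n := by simp [hr]
    rw [this]
    infer_instance

/-- A morphism all of whose components are split monomorphisms or split epimorphisms factors
through its image. -/
lemma exists_image (hY : minimalOn Λ J ((toHomotopy Λ).obj Y))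
    (hZ : minimalOn Λ J ((toHomotopy Λ).obj Z)) (v : Y ⟶ Z)
    (hv : ∀ i, IsSplitMono (v.f i) ∨ IsSplitEpi (v.f i)) :
    ∃ (W : CochainComplex (ProjCat Λ) ℤ) (p : Y ⟶ W) (q : W ⟶ Z),
      minimalOn Λ J ((toHomotopy Λ).obj W) ∧ p ≫ q = v ∧ IsSepic p ∧ IsSmonic q := by
  have key (i : ℤ) : ∃ (W : ProjCat Λ) (p : Y.X i ⟶ W) (q : W ⟶ Z.X i), (i ∉ J → IsZero W) ∧
      p ≫ q = v.f i ∧ IsSplitEpi p ∧ IsSplitMono q := by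
    rcases hv i with hi | hi
    · exact ⟨Y.X i, 𝟙 _, v.f i, isZero_X_of_minimalOn hY, Category.id_comp _, inferInstance, hi⟩
    · exact ⟨Z.X i, v.f i, 𝟙 _, isZero_X_of_minimalOn hZ, Category.comp_id _, hi, inferInstance⟩
  choose W p q hW hpq hp hq using key
  let δ (i : ℤ) : W i ⟶ W (i + 1) := section_ (p i) ≫ Y.d i (i + 1) ≫ p (i + 1)
  have hδq (i : ℤ) : δ i ≫ q (i + 1) = q i ≫ Z.d i (i + 1) := by
    have : section_ (p i) ≫ v.f i = q i := by rw [← hpq]; simp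
    simp only [δ, Category.assoc]
    rw [hpq, ← v.comm, reassoc_of% this]
  -- The chosen sections need not commute with the differentials; compatibility with `p` is checked
  -- after the monomorphism `q (i + 1)`.
  have hδp (i : ℤ) : p i ≫ δ i = Y.d i (i + 1) ≫ p (i + 1) := by
    rw [← cancel_mono (q (i + 1)), Category.assoc, hδq, reassoc_of% (hpq i), v.comm,
      Category.assoc, hpq]
  have hδδ (i : ℤ) : δ i ≫ δ (i + 1) = 0 := by
    rw [← cancel_epi (p i), reassoc_of% (hδp i), hδp, Y.d_comp_d_assoc]
    simp
  obtain ⟨C, e, f, r, hf, hr, hd⟩ := exists_complex_of_components W p q δ hδp hδq hδδ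
  refine ⟨C, f, r, ⟨isMinimalComplex_of_succ fun i => ?_, fun i hi => ?_⟩, ?_, fun i => ?_,
    fun i => ?_⟩
  · change IsRadicalMor (C.d i (i + 1))
    rw [hd]
    exact ((((hY.1.isRadicalMor_d _ _).comp_right _).comp_left _).comp_right _).comp_left _
  · change IsZero (C.X i)
    rw [e]
    exact hW i hi
  · ext1 i
    rw [HomologicalComplex.comp_f, hf, hr]
    simp [hpq]
  · rw [hf]
    infer_instance
  · rw [hr]
    infer_instance

end Factorizations

/-! ### Smonic, sepic and sirreducible morphisms -/

section Trichotomy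

/-- If at every cut `E` holds up to the cut or `M` holds after it, then either one of `E` and `M`
holds at each index, or both fail at some `n`, with `E` holding before `n` and `M` after `n`. -/
lemma exists_cut_of_forall {E M : ℤ → Prop} (h : ∀ i, (∀ j ≤ i, E j) ∨ ∀ j > i, M j) :
    (∀ j, E j ∨ M j) ∨ ∃ n, ¬ E n ∧ ¬ M n ∧ (∀ j < n, E j) ∧ ∀ j > n, M j := by
  by_contra! H
  obtain ⟨⟨n, hE, hM⟩, H⟩ := H
  obtain ⟨j, hj, hMj⟩ := H n hE hM fun j hj =>
    ((h j).resolve_right fun h' => hM (h' n hj)) j le_rfl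
  exact hMj (((h n).resolve_left fun h' => hE (h' n le_rfl)) j hj)

variable {Λ : Type u} [Ring Λ] {J : Set ℤ} {Y Z : CochainComplex (ProjCat Λ) ℤ}

/-- Splicing at each cut leaves at most one degree where `v` is neither split mono nor split epi. If
there is none, the image factorization decides; otherwise, splicing a factorization of that
component shows it is irreducible. -/
lemma isSmonic_or_isSepic_or_isSirreducible (hY : minimalOn Λ J ((toHomotopy Λ).obj Y))
    (hZ : minimalOn Λ J ((toHomotopy Λ).obj Z)) (v : Y ⟶ Z)
    (hv : ∀ (W : CochainComplex (ProjCat Λ) ℤ) (p : Y ⟶ W) (q : W ⟶ Z),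
      minimalOn Λ J ((toHomotopy Λ).obj W) → p ≫ q = v → IsSmonic p ∨ IsSepic q) :
    IsSmonic v ∨ IsSepic v ∨ IsSirreducible v := by
  -- Here `W` is `Y` up to degree `n` and `Z` beyond it, so up to isomorphisms `q` is `v` in degrees
  -- `≤ n` and `p` is `v` in degrees `> n`.
  have cut (n : ℤ) : (∀ j ≤ n, IsSplitEpi (v.f j)) ∨ ∀ j > n, IsSplitMono (v.f j) := by
    obtain ⟨W, p, q, hW, rfl, hp, hq, -, h⟩ := exists_splice hY hZ v n (𝟙 _) (v.f n)
      (Category.id_comp _) (isZero_X_of_minimalOn hY)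
    refine (hv W p q hW rfl).symm.imp (fun H j hj => ?_) (fun H j hj => ?_)
    · rcases hj.lt_or_eq with hj | rfl
      · have := hp j hj
        have := H j
        rw [HomologicalComplex.comp_f]
        infer_instance
      · exact h (H j)
    · have := hq j hj
      have := H j
      rw [HomologicalComplex.comp_f]
      infer_instance
  rcases exists_cut_of_forall cut with h | ⟨n, hE, hM, hlt, hgt⟩
  · obtain ⟨W, p, q, hW, rfl, hp, hq⟩ := exists_image hY hZ v fun i => (h i).symm
    rcases hv W p q hW rfl with H | H
    · refine Or.inl fun i => ?_
      have := H i
      have := hq i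
      rw [HomologicalComplex.comp_f]
      infer_instance
    · refine Or.inr (Or.inl fun i => ?_)
      have := H i
      have := hp i
      rw [HomologicalComplex.comp_f]
      infer_instance
  · refine Or.inr (Or.inr ⟨n, ⟨⟨hM, hE, fun M g h w => ?_⟩, hlt, hgt⟩, ?_⟩)
    · have hn : n ∈ J := by
        by_contra hn
        exact hM ⟨⟨0, (isZero_X_of_minimalOn hY hn).eq_of_src _ _⟩⟩
      obtain ⟨W, p, q, hW, hpq, -, -, hg, hh⟩ := exists_splice hY hZ v n g h w (absurd hn)
      exact (hv W p q hW hpq).symm.imp (fun H => hh (H n)) (fun H => hg (H n))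
    · rintro m ⟨hm, h1, h2⟩
      rcases lt_trichotomy m n with h | h | h
      · exact absurd (hlt m h) hm.2.1
      · exact h
      · exact absurd (hgt m h) hm.1

end Trichotomy

/-! ### Triangles of minimal complexes -/

section Triangles

variable {Λ : Type u} [Ring Λ] {X Y Z : CochainComplex (ProjCat Λ) ℤ} {u : X ⟶ Y} {v : Y ⟶ Z}
  {w : (toHomotopy Λ).obj Z ⟶ ((toHomotopy Λ).obj X)⟦(1 : ℤ)⟧}

-- Uniqueness of the cone, lifted to chain maps so that it can be computed degree by degree.
open CochainComplex mappingCone in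
lemma exists_mappingCone_homotopyEquiv
    (hT : Triangle.mk ((toHomotopy Λ).map u) ((toHomotopy Λ).map v) w ∈ distTriang _) :
    ∃ (φ : mappingCone u ⟶ Z) (ψ : Z ⟶ mappingCone u),
      (toHomotopy Λ).map (φ ≫ ψ) = (toHomotopy Λ).map (𝟙 _) ∧
      (toHomotopy Λ).map (ψ ≫ φ) = (toHomotopy Λ).map (𝟙 _) ∧
      (toHomotopy Λ).map (inr u ≫ φ) = (toHomotopy Λ).map v ∧
      (toHomotopy Λ).map (v ≫ ψ) = (toHomotopy Λ).map (inr u) := by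
  let e := isoTriangleOfIso₁₂ (triangleh u) _
    (HomotopyCategory.mappingCone_triangleh_distinguished u) hT (Iso.refl _) (Iso.refl _)
    ((Category.comp_id _).trans (Category.id_comp _).symm)
  have he : (toHomotopy Λ).map (inr u) ≫ e.hom.hom₃ = (toHomotopy Λ).map v := by
    exact e.hom.comm₂.trans (Category.id_comp _)
  obtain ⟨φ, hφ⟩ := (toHomotopy Λ).map_surjective
    (show (toHomotopy Λ).obj (mappingCone u) ⟶ (toHomotopy Λ).obj Z from e.hom.hom₃)
  obtain ⟨ψ, hψ⟩ := (toHomotopy Λ).map_surjective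
    (show (toHomotopy Λ).obj Z ⟶ (toHomotopy Λ).obj (mappingCone u) from e.inv.hom₃)
  have h1 : (toHomotopy Λ).map φ ≫ (toHomotopy Λ).map ψ = 𝟙 _ := by
    rw [hφ, hψ]
    exact e.hom_inv_id_triangle_hom₃
  have h2 : (toHomotopy Λ).map ψ ≫ (toHomotopy Λ).map φ = 𝟙 _ := by
    rw [hφ, hψ]
    exact e.inv_hom_id_triangle_hom₃
  have h3 : (toHomotopy Λ).map (inr u) ≫ (toHomotopy Λ).map φ = (toHomotopy Λ).map v := by
    rw [hφ]
    exact he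
  refine ⟨φ, ψ, ?_, ?_, ?_, ?_⟩ <;>
    simp only [CategoryTheory.Functor.map_comp, CategoryTheory.Functor.map_id]
  · exact h1
  · exact h2
  · exact h3
  · rw [← h3, Category.assoc, h1, Category.comp_id]

variable [IsArtinianRing Λᵐᵒᵖ]

open CochainComplex mappingCone HomComplex in
/-- In a distinguished triangle of minimal complexes, if the first morphism is degreewise split
mono, then the second is degreewise split epi. -/
lemma isSepic_of_isSmonic
    (hT : Triangle.mk ((toHomotopy Λ).map u) ((toHomotopy Λ).map v) w ∈ distTriang _)
    (hY : IsMinimalComplex Y) (hZ : IsMinimalComplex Z) (hu : IsSmonic u) : IsSepic v := by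
  obtain ⟨φ, ψ, -, h2, h3, -⟩ := exists_mappingCone_homotopyEquiv hT
  intro i
  have := hu (i + 1)
  -- The `Y`-component of the chain map identity for `ψ` expresses this `X`-component followed by
  -- `u` through differentials of `Z` and `Y`; the split mono `u` then cancels.
  have h4 : IsRadicalMor (ψ.f i ≫ (fst u).1.v i (i + 1) rfl) := by
    have : IsRadicalMor ((ψ.f i ≫ (fst u).1.v i (i + 1) rfl) ≫ u.f (i + 1)) := by
      have : (ψ.f i ≫ (fst u).1.v i (i + 1) rfl) ≫ u.f (i + 1) =
          Z.d i (i + 1) ≫ ψ.f (i + 1) ≫ (snd u).v _ _ (add_zero _) -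
            (ψ.f i ≫ (snd u).v _ _ (add_zero _)) ≫ Y.d i (i + 1) := by
        rw [← ψ.comm_assoc, d_snd_v u i (i + 1) rfl]
        simp
      rw [this]
      exact ((hZ.isRadicalMor_d _ _).comp_right _).sub ((hY.isRadicalMor_d _ _).comp_left _)
    exact this.of_comp_splitMono
  have h5 : ψ.f i ≫ φ.f i = (ψ.f i ≫ (fst u).1.v i (i + 1) rfl) ≫
      (inl u).v (i + 1) i (by lia) ≫ φ.f i +
      (ψ.f i ≫ (snd u).v i i (add_zero i)) ≫ (inr u).f i ≫ φ.f i := by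
    have := congrArg (fun t => ψ.f i ≫ t ≫ φ.f i) (id_X u i (i + 1) rfl)
    simpa using this.symm
  have h6 := isRadicalMor_sub_of_map_eq hZ hZ h2 i
  -- Since `ψ ≫ φ` is the identity modulo the radical and the `X`-component of `ψ` is radical, the
  -- `Y`-component of `ψ` is a section modulo the radical.
  have : IsSplitEpi ((inr u ≫ φ).f i) := by
    refine isSplitEpi_of_isRadicalMor_comp_sub_id (g := ψ.f i ≫ (snd u).v i i (add_zero i)) ?_
    have : (ψ.f i ≫ (snd u).v i i (add_zero i)) ≫ (inr u ≫ φ).f i - 𝟙 _ =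
        ((ψ ≫ φ).f i - (𝟙 Z : Z ⟶ Z).f i) - (ψ.f i ≫ (fst u).1.v i (i + 1) rfl) ≫
      (inl u).v (i + 1) i (by lia) ≫ φ.f i := by
      rw [HomologicalComplex.comp_f, HomologicalComplex.comp_f, h5, HomologicalComplex.id_f]
      abel
    rw [this]
    exact h6.sub (h4.comp_right _)
  exact isSplitEpi_of_isRadicalMor_sub (isRadicalMor_sub_of_map_eq hY hZ h3.symm i)

open CochainComplex mappingCone HomComplex in
/-- In a distinguished triangle of minimal complexes, if the second morphism is degreewise split
epi, then the first is degreewise split mono. -/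
lemma isSmonic_of_isSepic
    (hT : Triangle.mk ((toHomotopy Λ).map u) ((toHomotopy Λ).map v) w ∈ distTriang _)
    (hX : IsMinimalComplex X) (hY : IsMinimalComplex Y) (hv : IsSepic v) : IsSmonic u := by
  obtain ⟨φ, ψ, h1, -, -, h3⟩ := exists_mappingCone_homotopyEquiv hT
  intro n
  -- `X` in degree `i + 1` is a summand of the cone in degree `i`.
  obtain ⟨i, rfl⟩ : ∃ i, n = i + 1 := ⟨n - 1, by lia⟩
  have := hv i
  -- `v ≫ ψ` is homotopic to `inr u`, whose `X`-component vanishes, so only differential terms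
  -- remain; the split epi `v` then cancels.
  have h4 : IsRadicalMor (ψ.f i ≫ (fst u).1.v i (i + 1) rfl) := by
    have : IsRadicalMor (v.f i ≫ ψ.f i ≫ (fst u).1.v i (i + 1) rfl) := by
      obtain ⟨s, t, hst⟩ := exists_homotopy_components h3 i
      have : v.f i ≫ ψ.f i ≫ (fst u).1.v i (i + 1) rfl =
          Y.d i (i + 1) ≫ s ≫ (fst u).1.v i (i + 1) rfl -
            (t ≫ (fst u).1.v (i - 1) i (by lia)) ≫ X.d i (i + 1) := by
        rw [← Category.assoc, ← HomologicalComplex.comp_f, hst]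
        simp [d_fst_v u (i - 1) i (i + 1) (by lia) rfl, sub_eq_add_neg]
      rw [this]
      exact ((hY.isRadicalMor_d _ _).comp_right _).sub ((hX.isRadicalMor_d _ _).comp_left _)
    exact this.of_splitEpi_comp
  obtain ⟨s, t, hst⟩ := exists_homotopy_components h1 i
  -- The `X`-to-`X` entry of the homotopy from `φ ≫ ψ` to the identity. The cone differential brings
  -- in `u`; every term on the right is radical, so minus the `Y`-to-`X` entry of `s` retracts `u`
  -- modulo the radical.
  have h5 : u.f (i + 1) ≫ (inr u).f (i + 1) ≫ s ≫ (fst u).1.v i (i + 1) rfl + 𝟙 _ =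
      ((inl u).v (i + 1) i (by lia) ≫ φ.f i) ≫ ψ.f i ≫ (fst u).1.v i (i + 1) rfl +
      X.d (i + 1) (i + 2) ≫ (inl u).v (i + 2) (i + 1) (by lia) ≫ s ≫
        (fst u).1.v i (i + 1) rfl +
      ((inl u).v (i + 1) i (by lia) ≫ t ≫ (fst u).1.v (i - 1) i (by lia)) ≫
        X.d i (i + 1) := by
    have := congrArg (fun t => (inl u).v (i + 1) i (by lia) ≫ t ≫ (fst u).1.v i (i + 1) rfl) hst
    simp [d_fst_v u (i - 1) i (i + 1) (by lia) rfl,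
      inl_v_d_assoc u (i + 1) i (i + 2) (by lia) (by lia)] at this
    simp only [Category.assoc, this]
    abel
  refine isSplitMono_of_isRadicalMor_comp_sub_id
    (g := -((inr u).f (i + 1) ≫ s ≫ (fst u).1.v i (i + 1) rfl)) ?_
  have h6 : IsRadicalMor
      (u.f (i + 1) ≫ (inr u).f (i + 1) ≫ s ≫ (fst u).1.v i (i + 1) rfl + 𝟙 _) := by
    rw [h5]
    exact ((h4.comp_left _).add ((hX.isRadicalMor_d _ _).comp_right _)).add
      ((hX.isRadicalMor_d _ _).comp_left _)
  convert h6.neg using 1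
  simp [sub_eq_add_neg, add_comm]

end Triangles

/-! ### Auslander-Reiten triangles -/

section AuslanderReiten

variable {Λ : Type u} [Ring Λ] {J : Set ℤ}
  {X Y Z : CochainComplex (ProjCat Λ) ℤ} {u : X ⟶ Y} {v : Y ⟶ Z}
  {w : (toHomotopy Λ).obj Z ⟶ ((toHomotopy Λ).obj X)⟦(1 : ℤ)⟧}

lemma isRadicalMor_of_isSepic
    (hAR : IsAuslanderReitenTriangle (minimalOn Λ J)
      (Triangle.mk ((toHomotopy Λ).map u) ((toHomotopy Λ).map v) w))
    (hu : IsSepic u) (i : ℤ) : IsRadicalMor (v.f i) := by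
  have h : (toHomotopy Λ).map (u ≫ v) = (toHomotopy Λ).map 0 := by
    rw [Functor.map_comp, Functor.map_zero]
    exact comp_distTriang_mor_zero₁₂ _ hAR.distinguished
  have h1 : IsRadicalMor ((u ≫ v).f i - (0 : X ⟶ Z).f i) :=
    isRadicalMor_sub_of_map_eq hAR.indecomposable₁.1.1 hAR.indecomposable₃.1.1 h i
  rw [HomologicalComplex.zero_f, sub_zero] at h1
  have := hu i
  exact IsRadicalMor.of_splitEpi_comp (f := u.f i) h1

variable [IsArtinianRing Λᵐᵒᵖ]

/-- The second morphism of an Auslander-Reiten triangle is right minimal. -/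
lemma isIso_of_comp_eq
    (hAR : IsAuslanderReitenTriangle (minimalOn Λ J)
      (Triangle.mk ((toHomotopy Λ).map u) ((toHomotopy Λ).map v) w))
    (e : (toHomotopy Λ).obj Y ⟶ (toHomotopy Λ).obj Y)
    (he : e ≫ (toHomotopy Λ).map v = (toHomotopy Λ).map v) : IsIso e := by
  have hT := hAR.distinguished
  obtain ⟨a, ha1, ha3⟩ := complete_distinguished_triangle_morphism₁ _ _ hT hT e (𝟙 _)
    ((Category.comp_id _).trans he.symm)
  obtain ⟨a', rfl⟩ := (toHomotopy Λ).map_surjective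
    (show (toHomotopy Λ).obj X ⟶ (toHomotopy Λ).obj X from a)
  have ha3' : w ≫ ((toHomotopy Λ).map a')⟦(1 : ℤ)⟧' = w := ha3.trans (Category.id_comp _)
  -- If `a'` is invertible, so is `e`, by two-out-of-three for triangles. If `1 - a'` is, then `w`
  -- is killed by its invertible shift, so `w = 0`.
  rcases isIso_or_isIso_id_sub hAR.indecomposable₁ a' with h | h
  · let m : Triangle.mk ((toHomotopy Λ).map u) ((toHomotopy Λ).map v) w ⟶
        Triangle.mk ((toHomotopy Λ).map u) ((toHomotopy Λ).map v) w :=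
      { hom₁ := (toHomotopy Λ).map a'
        hom₂ := e
        hom₃ := 𝟙 _
        comm₁ := ha1
        comm₂ := (Category.comp_id _).trans he.symm
        comm₃ := ha3 }
    exact isIso₂_of_isIso₁₃ m hT hT (inferInstanceAs (IsIso ((toHomotopy Λ).map a')))
      (inferInstanceAs (IsIso (𝟙 _)))
  · refine absurd ?_ hAR.mor₃_ne_zero
    change w = 0
    have h1 : w ≫ ((toHomotopy Λ).map (𝟙 X - a'))⟦(1 : ℤ)⟧' = 0 := by
      rw [Functor.map_sub, Functor.map_sub, Preadditive.comp_sub, ha3',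
        CategoryTheory.Functor.map_id, CategoryTheory.Functor.map_id, Category.comp_id, sub_self]
    rwa [← cancel_mono (((toHomotopy Λ).map (𝟙 X - a'))⟦(1 : ℤ)⟧'), zero_comp]

/-- The second morphism of an Auslander-Reiten triangle is irreducible. -/
lemma isSmonic_or_isSepic_of_comp_eq
    (hAR : IsAuslanderReitenTriangle (minimalOn Λ J)
      (Triangle.mk ((toHomotopy Λ).map u) ((toHomotopy Λ).map v) w))
    (W : CochainComplex (ProjCat Λ) ℤ) (p : Y ⟶ W) (q : W ⟶ Z)
    (hW : minimalOn Λ J ((toHomotopy Λ).obj W)) (hpq : p ≫ q = v) : IsSmonic p ∨ IsSepic q := by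
  by_cases hq : IsSplitEpi ((toHomotopy Λ).map q)
  · exact Or.inr (isSepic_of_isSplitEpi_map hAR.indecomposable₃.1.1 hq)
  · left
    obtain ⟨g, hg⟩ := hAR.exists_lift _ hW ((toHomotopy Λ).map q) hq
    change (toHomotopy Λ).obj W ⟶ (toHomotopy Λ).obj Y at g
    change g ≫ (toHomotopy Λ).map v = _ at hg
    -- `p ≫ g` fixes `v`, so right minimality makes it invertible and `p` split mono up to homotopy.
    obtain ⟨r, hr, -⟩ := (isIso_of_comp_eq hAR ((toHomotopy Λ).map p ≫ g) (by
      rw [Category.assoc, hg, ← Functor.map_comp, hpq])).out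
    exact isSmonic_of_isSplitMono_map hAR.mem₂.1
      ⟨⟨g ≫ r, (Category.assoc _ _ _).symm.trans hr⟩⟩

end AuslanderReiten

theorem theorem1 {k : Type*} [Field k] {Λ : Type u} [Ring Λ] [Algebra k Λ] [FiniteDimensional k Λ]
    (hΛ : ¬ IsSemisimpleRing Λ)
    (J : Set ℤ) (hJ : J.OrdConnected)
    {X Y Z : CochainComplex (ProjCat Λ) ℤ} (u : X ⟶ Y) (v : Y ⟶ Z)
    (w : (HomotopyCategory.quotient (ProjCat Λ) (ComplexShape.up ℤ)).obj Z ⟶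
      ((HomotopyCategory.quotient (ProjCat Λ) (ComplexShape.up ℤ)).obj X)⟦(1 : ℤ)⟧)
    (hAR : IsAuslanderReitenTriangle (minimalOn Λ J)
      (Triangle.mk ((HomotopyCategory.quotient (ProjCat Λ) (ComplexShape.up ℤ)).map u)
        ((HomotopyCategory.quotient (ProjCat Λ) (ComplexShape.up ℤ)).map v) w)) :
    (IsSmonic u → IsSepic v) ∧
    (¬ IsZero Y → IsSepic u → IsSirreducible v) ∧
    (IsSirreducible u → IsSmonic v ∨ IsSirreducible v) := by
  have : IsArtinianRing Λᵐᵒᵖ := IsArtinianRing.of_finite k Λᵐᵒᵖ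
  have hX := hAR.indecomposable₁.1
  have hY := hAR.mem₂
  have hZ := hAR.indecomposable₃.1
  have tri := isSmonic_or_isSepic_or_isSirreducible hY hZ v (isSmonic_or_isSepic_of_comp_eq hAR)
  refine ⟨isSepic_of_isSmonic hAR.distinguished hY.1 hZ.1, fun hY0 hu => ?_, fun hu => ?_⟩
  · have hv := isRadicalMor_of_isSepic hAR hu
    rcases tri with h | h | h
    · refine absurd (isZero_of_isZero_X fun i => ?_) hY0
      have := h i
      exact isZero_of_isRadicalMor_of_isSplitMono (hv i)
    · refine absurd ((toHomotopy Λ).map_isZero (isZero_of_isZero_X fun i => ?_))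
        hAR.indecomposable₃.2.1
      have := h i
      exact isZero_of_isRadicalMor_of_isSplitEpi (hv i)
    · exact h
  · rcases tri with h | h | h
    · exact Or.inl h
    -- A sepic `v` would make `u` smonic, against its irreducible component.
    · obtain ⟨n, ⟨hn, -⟩, -⟩ := hu
      exact absurd (isSmonic_of_isSepic hAR.distinguished hX.1 hY.1 h n) hn.1
    · exact Or.inr h
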